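/- Theorem. Let $n\ge 0$ and $k\ge 1$ be integers. Put $s_i=(2^k+1)\,2^{n+i}-(2^k-1)$ for $i\in\mathbb N=\{0,1,2,\dots\}$, and let $GT(n,k)=\langle\{s_i : i\in\mathbb N\}\rangle$ be the submonoid of $(\mathbb N,+)$ generated by all the $s_i$. For $S=GT(n,k)$ let $Ap(S,s_0)=\{a\in S : a-s_0\notin S\}$ be the Apéry set and let $F(S)$ be the Frobenius number, i.e. the greatest integer not belonging to $S$. Call integers $t_1,\dots,t_m\in\{0,1,2\}$ *admissible* if $t_j=2$ implies $t_i=0$ for all $i<j$, and put $$P_m=\sum_{i=1}^m(2^i-1)\,t_i,\qquad Q_m=\sum_{i=1}^m t_i s_i .$$ Then $\max Ap(GT(n,k),s_0)$ and $F(GT(n,k))$ exist and are given as follows. 1. If $n=0$: $\max Ap=s_1$ and $F=s_1-2$ (here $s_0=2$). 2. If $n\ge 1$ and $k=1$: $\max Ap=s_n+s_{n+1}$ and $F=s_n+s_{n+1}-s_0$. 3. If $2\le k<n$: there are admissible $t_1,\dots,t_{n-2}$ with $P_{n-2}=2^{n-1}-2^k+2$, and for any such choice $\max Ap=Q_{n-2}+s_{n-1}+s_{n+k}$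 and $F=Q_{n-2}+s_{n-1}+s_{n+k}-s_0$. 4. If $n=k\ge 1$: $\max Ap=s_1+s_{2n}$ and $F=s_1+s_{2n}-s_0$. 5. If $n\ge 1$, $k>n$ and $k\ne 2$: there are admissible $t_1,\dots,t_{k-1}$ with $P_{k-1}=2^n+n$, and for any such choice $\max Ap=Q_{k-1}+s_k+s_{k+1}+\dots+s_{n+k-1}$ and $F=Q_{k-1}+s_k+s_{k+1}+\dots+s_{n+k-1}-s_0$. 6. If $n=1$ and $k=2$: $\max Ap=74$ and $F=67$. -/

import Mathlib

namespace GenThabit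

/-- The generator `s_i = (2^k + 1) * 2^(n+i) - (2^k - 1)`. The subtractions of natural numbers never
truncate, see `cast_s`. -/
def s (n k i : ℕ) : ℕ := (2 ^ k + 1) * 2 ^ (n + i) - (2 ^ k - 1)

theorem cast_s (n k i : ℕ) :
    (s n k i : ℤ) = (2 ^ k + 1) * 2 ^ (n + i) - (2 ^ k - 1) := by
  have h1 : 1 ≤ 2 ^ k := Nat.one_le_two_pow
  have h2 : 1 ≤ 2 ^ (n + i) := Nat.one_le_two_pow
  have h3 : 2 ^ k - 1 ≤ (2 ^ k + 1) * 2 ^ (n + i) := by nlinarith [Nat.sub_le (2 ^ k) 1]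
  unfold s
  push_cast [Nat.cast_sub h3, Nat.cast_sub h1]
  ring

/-- The generalized Thabit numerical semigroup `GT(n,k)`: the submonoid of `(ℕ, +)` generated by
all the `s_i`, `i ∈ ℕ`. -/
def GThabit (n k : ℕ) : AddSubmonoid ℕ := AddSubmonoid.closure (Set.range (s n k))

/-- The Apéry set `Ap(S,x) = {a ∈ S | a - x ∉ S}`, the difference being taken in `ℤ`. -/
def Ap (S : AddSubmonoid ℕ) (x : ℕ) : Set ℕ := {a | a ∈ S ∧ ∀ b ∈ S, (b : ℤ) ≠ (a : ℤ) - (x : ℤ)}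

/-- The condition on the coefficients `t_1, …, t_m`: they all lie in `{0, 1, 2}`, and whenever
`t_j = 2`, all the coefficients before `t_j` are zero. -/
def Admissible (m : ℕ) (t : ℕ → ℕ) : Prop :=
  (∀ i ∈ Finset.Icc 1 m, t i ≤ 2) ∧
    ∀ j ∈ Finset.Icc 1 m, t j = 2 → ∀ i ∈ Finset.Icc 1 m, i < j → t i = 0

/-- `P_m = t_1 + (2^2 - 1) t_2 + ⋯ + (2^m - 1) t_m`. -/
def P (m : ℕ) (t : ℕ → ℕ) : ℕ := ∑ i ∈ Finset.Icc 1 m, (2 ^ i - 1) * t i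

/-- `Q_m = t_1 s_1 + ⋯ + t_m s_m`. -/
def Q (n k m : ℕ) (t : ℕ → ℕ) : ℕ := ∑ i ∈ Finset.Icc 1 m, t i * s n k i

end GenThabit

/-!
Write `c = 2 ^ k - 1`, so that `s_i = c * (2 ^ i - 1) + s_0 * 2 ^ i`. A sum of generators has the
form `c * x + s_0 * w`, where `w` is a sum of powers of two `2 ^ i` and `x` the sum of the
corresponding `2 ^ i - 1`. By Legendre's formula the pairs `(x, w)` that occur are exactly those
with `2 ^ x ∣ w !`, so

  `GT(n,k) = {c * x + s_0 * w | 2 ^ x ∣ w !}`.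

Since `c` is coprime to `s_0`, the residue class of an element modulo `s_0` is that of `c * x` with
`0 ≤ x < s_0`, and the hardest class to reach is that of `x = s_0 - 1`. Its least element is
`c * (s_0 - 1) + s_0 * w` for the least `w` with `2 ^ (s_0 - 1) ∣ w !`. Admissible coefficients are
the greedy ones: the least `w` with `2 ^ P_m ∣ w !` is `2 t_1 + ⋯ + 2^m t_m`. So `Q_m` is the
maximum of the Apéry set as soon as `P_m = s_0 - 1`, and each case of the theorem is a choice of
admissible coefficients with this property.
-/

namespace GenThabit

open scoped Nat

section Factorial

variable {p : ℕ} [Fact p.Prime]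

theorem padicValNat_factorial_eq_add_div (w : ℕ) :
    padicValNat p w ! = padicValNat p (w / p)! + w / p := by
  rw [← padicValNat_mul_div_factorial, padicValNat_factorial_mul]

theorem padicValNat_factorial_pow_mul_add (q : ℕ) {j u : ℕ} (hu : u < p ^ j) :
    padicValNat p (p ^ j * q + u)! = padicValNat p (p ^ j * q)! + padicValNat p u ! := by
  have hp : 0 < p := (Fact.out : p.Prime).pos
  induction j generalizing u with
  | zero => simp [Nat.lt_one_iff.1 hu]
  | succ j ih =>
    have hdiv : u / p < p ^ j := Nat.div_lt_of_lt_mul (by rwa [← pow_succ'])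
    rw [pow_succ', mul_assoc, padicValNat_factorial_eq_add_div (p * (p ^ j * q) + u),
      Nat.mul_add_div hp, ih hdiv, padicValNat_factorial_mul, padicValNat_factorial_eq_add_div u]
    ring

theorem padicValNat_factorial_add_le_of_lt_pow {j w : ℕ} (hw : w < p ^ j) :
    padicValNat p w ! + j ≤ padicValNat p (p ^ j)! := by
  have hpow : p ^ j ≠ 0 := by omega
  have hdvd : w ! * p ^ j ∣ (p ^ j)! := by
    rw [← Nat.mul_factorial_pred hpow, mul_comm]
    exact mul_dvd_mul_left _ (Nat.factorial_dvd_factorial (by omega))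
  rw [← padicValNat.prime_pow (p := p) j, ← padicValNat.mul (Nat.factorial_ne_zero w) hpow,
    padicValNat.prime_pow, ← padicValNat_dvd_iff_le (Nat.factorial_ne_zero _)]
  exact pow_padicValNat_dvd.trans hdvd

theorem padicValNat_two_factorial_two_pow (j : ℕ) : padicValNat 2 (2 ^ j)! = 2 ^ j - 1 := by
  induction j with
  | zero => simp
  | succ j ih =>
    rw [pow_succ', padicValNat_factorial_mul, ih]
    omega

theorem padicValNat_two_factorial_add_lt {j w : ℕ} (hw : w < 2 ^ j) :
    padicValNat 2 w ! + j < 2 ^ j := by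
  have hle := padicValNat_factorial_add_le_of_lt_pow hw
  rw [padicValNat_two_factorial_two_pow] at hle
  omega

/-- The additive monoid of the pairs `(x, w)` such that `p ^ x` divides `w !`. For `p = 2` it
contains the pairs `(2 ^ i - 1, 2 ^ i)`. -/
def dvdFactorial (p : ℕ) : AddSubmonoid (ℕ × ℕ) where
  carrier := {q | p ^ q.1 ∣ q.2 !}
  zero_mem' := by simp
  add_mem' {q r} hq hr := by
    have := (mul_dvd_mul hq hr).trans (Nat.factorial_mul_factorial_dvd_factorial_add q.2 r.2)
    rwa [← pow_add] at this

theorem mem_dvdFactorial {p x w : ℕ} : (x, w) ∈ dvdFactorial p ↔ p ^ x ∣ w ! := Iff.rfl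

theorem two_pow_sub_one_mem_dvdFactorial (i : ℕ) : (2 ^ i - 1, 2 ^ i) ∈ dvdFactorial 2 := by
  rw [mem_dvdFactorial, ← padicValNat_two_factorial_two_pow]
  exact pow_padicValNat_dvd

end Factorial

section Weight

variable {m w : ℕ} {t : ℕ → ℕ}

/-- The weight `2 t_1 + 4 t_2 + ⋯ + 2^m t_m` of a sequence of coefficients, so that
`Q_m = (2^k - 1) P_m + s_0 * weight`. -/
def weight (m : ℕ) (t : ℕ → ℕ) : ℕ := ∑ i ∈ Finset.Icc 1 m, 2 ^ i * t i

theorem weight_succ (m : ℕ) (t : ℕ → ℕ) :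
    weight (m + 1) t = weight m t + 2 ^ (m + 1) * t (m + 1) :=
  Finset.sum_Icc_succ_top (by omega) _

theorem P_succ (m : ℕ) (t : ℕ → ℕ) :
    P (m + 1) t = P m t + (2 ^ (m + 1) - 1) * t (m + 1) :=
  Finset.sum_Icc_succ_top (by omega) _

theorem P_le_weight (m : ℕ) (t : ℕ → ℕ) : P m t ≤ weight m t :=
  Finset.sum_le_sum fun _ _ => Nat.mul_le_mul_right _ (Nat.sub_le _ _)

theorem P_weight_mem_dvdFactorial (m : ℕ) (t : ℕ → ℕ) : (P m t, weight m t) ∈ dvdFactorial 2 := by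
  have hsum : (P m t, weight m t) = ∑ i ∈ Finset.Icc 1 m, t i • (2 ^ i - 1, 2 ^ i) := by
    simp [Prod.ext_iff, Prod.fst_sum, Prod.snd_sum, P, weight, mul_comm]
  rw [hsum]
  exact sum_mem fun i _ => nsmul_mem (two_pow_sub_one_mem_dvdFactorial i) _

theorem Admissible.of_succ (h : Admissible (m + 1) t) : Admissible m t := by
  have hsub := Finset.Icc_subset_Icc_right (a := 1) m.le_succ
  exact ⟨fun i hi => h.1 i (hsub hi), fun j hj hj2 i hi => h.2 j (hsub hj) hj2 i (hsub hi)⟩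

theorem Admissible.weight_eq_zero_of_top_eq_two (h : Admissible (m + 1) t) (h2 : t (m + 1) = 2) :
    weight m t = 0 := by
  refine Finset.sum_eq_zero fun i hi => ?_
  rw [Finset.mem_Icc] at hi
  rw [h.2 (m + 1) (by simp) h2 i (by rw [Finset.mem_Icc]; omega) (by omega), mul_zero]

theorem Admissible.weight_le (h : Admissible m t) : weight m t ≤ 2 ^ (m + 1) := by
  induction m with
  | zero => simp [weight]
  | succ m ih =>
    have hlow := ih h.of_succ
    have htop := h.1 (m + 1) (by simp)
    rw [weight_succ, pow_succ 2 (m + 1)]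
    interval_cases hv : t (m + 1)
    · omega
    · omega
    · rw [h.weight_eq_zero_of_top_eq_two hv, zero_add]

theorem Admissible.padicValNat_factorial_lt_P (h : Admissible m t) (hw : w < weight m t) :
    padicValNat 2 w ! < P m t := by
  induction m generalizing w with
  | zero => simp [weight] at hw
  | succ m ih =>
    have htop := h.1 (m + 1) (by simp)
    rw [weight_succ] at hw
    rw [P_succ]
    interval_cases hv : t (m + 1)
    · simpa using ih h.of_succ (by simpa using hw)
    · rw [mul_one] at hw ⊢
      rcases lt_or_ge w (2 ^ (m + 1)) with hlt | hge
      · have := padicValNat_two_factorial_add_lt hlt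
        omega
      · obtain ⟨u, rfl⟩ := Nat.exists_eq_add_of_le hge
        have hu : u < weight m t := by omega
        have hsplit := padicValNat_factorial_pow_mul_add 1 (hu.trans_le h.of_succ.weight_le)
        rw [mul_one, padicValNat_two_factorial_two_pow] at hsplit
        have := ih h.of_succ hu
        omega
    · rw [h.weight_eq_zero_of_top_eq_two hv, zero_add, ← pow_succ] at hw
      have := padicValNat_two_factorial_add_lt hw
      rw [pow_succ] at this
      omega

theorem Admissible.weight_le_of_mem_dvdFactorial (h : Admissible m t)
    (hw : (P m t, w) ∈ dvdFactorial 2) : weight m t ≤ w := by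
  by_contra! hlt
  rw [mem_dvdFactorial, padicValNat_dvd_iff_le (Nat.factorial_ne_zero w)] at hw
  exact (h.padicValNat_factorial_lt_P hlt).not_ge hw

end Weight

section Coefficients

variable {m : ℕ} {t : ℕ → ℕ}

/-- The sequence that agrees with `t` up to the index `m` and with the indicator of `A` after it.
It lets the terms `s_i`, `i ∈ A`, of a formula for the maximum be absorbed into `Q`. -/
def appendOnes (m : ℕ) (t : ℕ → ℕ) (A : Finset ℕ) (i : ℕ) : ℕ :=
  if i ≤ m then t i else if i ∈ A then 1 else 0

theorem sum_mul_appendOnes {L : ℕ} (hmL : m ≤ L) (t : ℕ → ℕ) {A : Finset ℕ}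
    (hA : A ⊆ Finset.Ioc m L) (f : ℕ → ℕ) :
    ∑ i ∈ Finset.Icc 1 L, f i * appendOnes m t A i =
      ∑ i ∈ Finset.Icc 1 m, f i * t i + ∑ i ∈ A, f i := by
  have hlow : ∑ i ∈ Finset.Ioc 0 m, f i * appendOnes m t A i = ∑ i ∈ Finset.Ioc 0 m, f i * t i :=
    Finset.sum_congr rfl fun i hi => by rw [appendOnes, if_pos (Finset.mem_Ioc.1 hi).2]
  have hhigh : ∑ i ∈ Finset.Ioc m L, f i * appendOnes m t A i = ∑ i ∈ A, f i := by
    rw [← Finset.inter_eq_right.2 hA, ← Finset.sum_ite_mem]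
    refine Finset.sum_congr rfl fun i hi => ?_
    rw [appendOnes, if_neg (Finset.mem_Ioc.1 hi).1.not_ge, mul_ite, mul_one, mul_zero,
      Finset.inter_eq_right.2 hA]
  change ∑ i ∈ Finset.Ioc 0 L, _ = ∑ i ∈ Finset.Ioc 0 m, _ + _
  rw [← Finset.sum_Ioc_consecutive _ m.zero_le hmL, hlow, hhigh]

theorem P_appendOnes {L : ℕ} (hmL : m ≤ L) (t : ℕ → ℕ) {A : Finset ℕ} (hA : A ⊆ Finset.Ioc m L) :
    P L (appendOnes m t A) = P m t + ∑ i ∈ A, (2 ^ i - 1) :=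
  sum_mul_appendOnes hmL t hA _

theorem Q_appendOnes (n k : ℕ) {L : ℕ} (hmL : m ≤ L) (t : ℕ → ℕ) {A : Finset ℕ}
    (hA : A ⊆ Finset.Ioc m L) :
    Q n k L (appendOnes m t A) = Q n k m t + ∑ i ∈ A, s n k i := by
  simpa only [Q, mul_comm] using sum_mul_appendOnes hmL t hA (s n k)

theorem Admissible.admissible_appendOnes (ht : Admissible m t) (A : Finset ℕ) (L : ℕ) :
    Admissible L (appendOnes m t A) := by
  simp only [Admissible, appendOnes, Finset.mem_Icc] at ht ⊢
  refine ⟨fun i hi => ?_, fun j hj hj2 i hi hij => ?_⟩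
  · split_ifs with him
    · exact ht.1 i ⟨hi.1, him⟩
    · norm_num
    · norm_num
  · have hjm : j ≤ m := by
      by_contra hjm
      rw [if_neg hjm] at hj2
      split_ifs at hj2
      omega
    rw [if_pos hjm] at hj2
    rw [if_pos (hij.le.trans hjm)]
    exact ht.2 j ⟨hj.1, hjm⟩ hj2 i ⟨hi.1, hij.le.trans hjm⟩ hij

theorem admissible_single_two (m j : ℕ) : Admissible m (Pi.single j 2) := by
  simp only [Admissible, Pi.single_apply]
  refine ⟨fun i _ => ?_, fun i _ hi l _ hl => ?_⟩
  · split_ifs <;> norm_num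
  · split_ifs at hi ⊢ <;> omega

theorem exists_admissible_P_eq (m : ℕ) {r : ℕ} (hr : r + 2 ≤ 2 ^ (m + 1)) :
    ∃ t, Admissible m t ∧ P m t = r := by
  induction m generalizing r with
  | zero =>
    obtain rfl : r = 0 := by omega
    exact ⟨0, by simp [Admissible], by simp [P]⟩
  | succ m ih =>
    rw [pow_succ] at hr
    have hpow : 1 ≤ 2 ^ (m + 1) := Nat.one_le_two_pow
    rcases le_or_gt (r + 2) (2 ^ (m + 1)) with hsmall | hlarge
    · obtain ⟨t, ht, rfl⟩ := ih hsmall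
      exact ⟨_, ht.admissible_appendOnes ∅ _, by simp [P_appendOnes m.le_succ]⟩
    rcases hr.eq_or_lt with htop | hlt
    · refine ⟨_, admissible_single_two (m + 1) (m + 1), ?_⟩
      simp only [P, Pi.single_apply, mul_ite, mul_zero, Finset.sum_ite_eq', Finset.mem_Icc]
      rw [if_pos (by omega)]
      omega
    · obtain ⟨t, ht, hP⟩ := ih (r := r + 1 - 2 ^ (m + 1)) (by omega)
      refine ⟨_, ht.admissible_appendOnes {m + 1} _, ?_⟩
      rw [P_appendOnes m.le_succ t (by simp), hP, Finset.sum_singleton]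
      omega

end Coefficients

section DoublingSubmonoid

variable {c m L y : ℕ} {t : ℕ → ℕ}

/-- The submonoid generated by the sequence `g` with `g 0 = m` and `g (i + 1) = 2 * g i + c`,
written in closed form. Thabit semigroups are the case `c = 2 ^ k - 1`, `m = s_0`. -/
def doublingSubmonoid (c m : ℕ) : AddSubmonoid ℕ :=
  AddSubmonoid.closure (Set.range fun i : ℕ => c * (2 ^ i - 1) + m * 2 ^ i)

theorem exists_dvdFactorial_of_mem_doublingSubmonoid (hy : y ∈ doublingSubmonoid c m) :
    ∃ x w, (x, w) ∈ dvdFactorial 2 ∧ y = c * x + m * w := by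
  induction hy using AddSubmonoid.closure_induction with
  | mem y hy =>
    obtain ⟨i, rfl⟩ := hy
    exact ⟨_, _, two_pow_sub_one_mem_dvdFactorial i, rfl⟩
  | zero => exact ⟨0, 0, zero_mem _, rfl⟩
  | add a b _ _ ha hb =>
    obtain ⟨x, w, hxw, rfl⟩ := ha
    obtain ⟨x', w', hxw', rfl⟩ := hb
    exact ⟨x + x', w + w', add_mem hxw hxw', by ring⟩

theorem P_add_weight_eq_sum (c m L : ℕ) (t : ℕ → ℕ) :
    c * P L t + m * weight L t =
      ∑ i ∈ Finset.Icc 1 L, t i * (c * (2 ^ i - 1) + m * 2 ^ i) := by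
  rw [P, weight, Finset.mul_sum, Finset.mul_sum, ← Finset.sum_add_distrib]
  exact Finset.sum_congr rfl fun i _ => by ring

theorem P_add_weight_mem_doublingSubmonoid (c m L : ℕ) (t : ℕ → ℕ) :
    c * P L t + m * weight L t ∈ doublingSubmonoid c m := by
  rw [P_add_weight_eq_sum]
  exact sum_mem fun i _ => nsmul_mem (AddSubmonoid.subset_closure (Set.mem_range_self i)) _

theorem mem_doublingSubmonoid_of_dvdFactorial {x w : ℕ} (hxw : (x, w) ∈ dvdFactorial 2) :
    c * x + m * w ∈ doublingSubmonoid c m := by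
  obtain ⟨t, ht, hP⟩ : ∃ t, Admissible x t ∧ P x t = x := exists_admissible_P_eq x (by
    have := Nat.lt_two_pow_self (n := x)
    rw [pow_succ]
    omega)
  have hle : weight x t ≤ w := ht.weight_le_of_mem_dvdFactorial (by rwa [hP])
  obtain ⟨d, rfl⟩ := Nat.exists_eq_add_of_le hle
  have hgen : m ∈ doublingSubmonoid c m := AddSubmonoid.subset_closure ⟨0, by simp⟩
  have hsplit : c * x + m * (weight x t + d) = c * P x t + m * weight x t + d • m := by
    rw [hP, smul_eq_mul]
    ring
  rw [hsplit]
  exact add_mem (P_add_weight_mem_doublingSubmonoid c m x t) (nsmul_mem hgen d)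

theorem mem_doublingSubmonoid :
    y ∈ doublingSubmonoid c m ↔ ∃ x w, (x, w) ∈ dvdFactorial 2 ∧ y = c * x + m * w :=
  ⟨exists_dvdFactorial_of_mem_doublingSubmonoid, by
    rintro ⟨x, w, hxw, rfl⟩
    exact mem_doublingSubmonoid_of_dvdFactorial hxw⟩

theorem Admissible.notMem_doublingSubmonoid {w : ℕ} (ht : Admissible L t)
    (hcm : c.Coprime m) (hP : P L t + 1 = m) (hw : w < weight L t) :
    c * P L t + m * w ∉ doublingSubmonoid c m := by
  rw [mem_doublingSubmonoid]
  rintro ⟨x, w', hxw, heq⟩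
  have hmod : P L t ≡ x [MOD m] := by
    refine Nat.ModEq.cancel_left_of_coprime hcm.symm ?_
    simpa [Nat.ModEq] using congrArg (· % m) heq
  have hx : P L t ≤ x := by
    rw [← Nat.mod_eq_of_lt (show P L t < m by omega), hmod]
    exact Nat.mod_le _ _
  have hw' : w < w' :=
    hw.trans_le (ht.weight_le_of_mem_dvdFactorial ((pow_dvd_pow 2 hx).trans hxw))
  have : m * w < m * w' := Nat.mul_lt_mul_of_pos_left hw' (by omega)
  have := Nat.mul_le_mul_left c hx
  omega

theorem mem_doublingSubmonoid_of_lt (hcm : c.Coprime m) (hP : P L t + 1 = m)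
    (hy : c * P L t + m * (weight L t - 1) < y) : y ∈ doublingSubmonoid c m := by
  obtain ⟨r, hrm, hmod⟩ : ∃ r < m, c * r ≡ y [MOD m] :=
    Nat.exists_mul_mod_eq_of_coprime y hcm (by omega)
  have hcr : c * r ≤ c * P L t := Nat.mul_le_mul_left _ (by omega)
  have hry : c * r ≤ y := by omega
  obtain ⟨w, hw⟩ := (Nat.modEq_iff_dvd' hry).1 hmod
  have hlt : weight L t - 1 < w := Nat.lt_of_mul_lt_mul_left (a := m) (by omega)
  refine mem_doublingSubmonoid.2 ⟨r, w, ?_, by omega⟩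
  calc 2 ^ r ∣ 2 ^ P L t := pow_dvd_pow 2 (by omega)
    _ ∣ (weight L t)! := P_weight_mem_dvdFactorial L t
    _ ∣ w ! := Nat.factorial_dvd_factorial (by omega)

theorem frobeniusNumber_doublingSubmonoid {w : ℕ} (ht : Admissible L t) (hcm : c.Coprime m)
    (hP : P L t + 1 = m) (hw : weight L t = w + 1) :
    FrobeniusNumber (c * P L t + m * w) (doublingSubmonoid c m : Set ℕ) := by
  rw [frobeniusNumber_iff, AddSubmonoid.closure_eq]
  exact ⟨ht.notMem_doublingSubmonoid hcm hP (by omega), fun y hy =>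
    mem_doublingSubmonoid_of_lt hcm hP (hw ▸ hy)⟩

end DoublingSubmonoid

section Apery

variable {S : AddSubmonoid ℕ} {F x : ℕ}

/-- `a` is the maximum of the Apéry set of `S` with respect to `x`, and `a - x` is the Frobenius
number of `S`. The subtraction truncates if `a < x`. -/
def IsMaxApery (S : AddSubmonoid ℕ) (x a : ℕ) : Prop :=
  IsGreatest (Ap S x) a ∧ FrobeniusNumber (a - x) (S : Set ℕ)

theorem isMaxApery_add_of_frobeniusNumber (hF : FrobeniusNumber F (S : Set ℕ)) (hx : 0 < x) :
    IsMaxApery S x (F + x) := by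
  refine ⟨?_, by rwa [Nat.add_sub_cancel]⟩
  rw [frobeniusNumber_iff, AddSubmonoid.closure_eq] at hF
  obtain ⟨hF, hgt⟩ := hF
  refine ⟨⟨hgt _ (by omega), fun b hb h => hF ?_⟩, fun a ha => ?_⟩
  · rwa [show F = b by omega]
  · by_contra! hlt
    exact ha.2 (a - x) (hgt _ (by omega)) (by omega)

end Apery

theorem sum_Ico_two_pow_sub_one (k n : ℕ) :
    ∑ i ∈ Finset.Ico k (n + k), (2 ^ i - 1) + n + 2 ^ k = 2 ^ (n + k) := by
  induction n with
  | zero => simp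
  | succ n ih =>
    have hone : 1 ≤ 2 ^ (n + k) := Nat.one_le_two_pow
    rw [add_right_comm n 1 k, Finset.sum_Ico_succ_top (by omega), pow_succ]
    omega

section GThabit

variable {n k m : ℕ} {t : ℕ → ℕ}

theorem s_zero_add_two_pow (n k : ℕ) : s n k 0 + 2 ^ k = 2 ^ (n + k) + 2 ^ n + 1 := by
  zify
  rw [cast_s]
  ring

theorem two_le_s_zero (n k : ℕ) : 2 ≤ s n k 0 := by
  have hadd := s_zero_add_two_pow n k
  have hpow : 2 ^ k ≤ 2 ^ (n + k) := Nat.pow_le_pow_right two_pos (by omega)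
  have hone : 1 ≤ 2 ^ n := Nat.one_le_two_pow
  omega

theorem s_eq_mul_add_mul (n k i : ℕ) :
    s n k i = (2 ^ k - 1) * (2 ^ i - 1) + s n k 0 * 2 ^ i := by
  zify [Nat.one_le_two_pow (n := k), Nat.one_le_two_pow (n := i)]
  rw [cast_s, cast_s]
  ring

theorem GThabit_eq_doublingSubmonoid (n k : ℕ) :
    GThabit n k = doublingSubmonoid (2 ^ k - 1) (s n k 0) := by
  simp only [GThabit, doublingSubmonoid, ← s_eq_mul_add_mul]

theorem Q_eq_P_add_weight (n k m : ℕ) (t : ℕ → ℕ) :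
    Q n k m t = (2 ^ k - 1) * P m t + s n k 0 * weight m t := by
  simp only [P_add_weight_eq_sum, Q, ← s_eq_mul_add_mul]

theorem coprime_two_pow_sub_one_s_zero (n : ℕ) (hk : 1 ≤ k) :
    Nat.Coprime (2 ^ k - 1) (s n k 0) := by
  have hone : 1 ≤ 2 ^ k := Nat.one_le_two_pow
  have hodd : Nat.Coprime (2 ^ k - 1) 2 :=
    Nat.coprime_two_right.2 (Nat.Even.sub_odd hone (even_two.pow_of_ne_zero (by omega)) odd_one)
  have hadd : s n k 0 + (2 ^ k - 1) = (2 ^ k - 1) * 2 ^ n + 2 ^ (n + 1) := by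
    zify [hone]
    rw [cast_s]
    ring
  rw [← Nat.coprime_add_self_right, hadd, Nat.coprime_mul_left_add_right]
  exact hodd.pow_right _

theorem isMaxApery_Q (hk : 1 ≤ k) (ht : Admissible m t) (hP : P m t + 1 = s n k 0) :
    IsMaxApery (GThabit n k) (s n k 0) (Q n k m t) := by
  rw [GThabit_eq_doublingSubmonoid, Q_eq_P_add_weight]
  have hs := two_le_s_zero n k
  have hle := P_le_weight m t
  obtain ⟨w, hw⟩ : ∃ w, weight m t = w + 1 := Nat.exists_eq_succ_of_ne_zero (by omega)
  rw [hw, mul_add_one, ← add_assoc]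
  exact isMaxApery_add_of_frobeniusNumber
    (frobeniusNumber_doublingSubmonoid ht (coprime_two_pow_sub_one_s_zero n hk) hP hw) (by omega)

theorem isMaxApery_Q_add_sum (hk : 1 ≤ k) (ht : Admissible m t) {A : Finset ℕ}
    (hA : ∀ i ∈ A, m < i) (hP : P m t + ∑ i ∈ A, (2 ^ i - 1) + 1 = s n k 0) :
    IsMaxApery (GThabit n k) (s n k 0) (Q n k m t + ∑ i ∈ A, s n k i) := by
  have hle : m ≤ m + A.sup id := Nat.le_add_right _ _
  have hAL : A ⊆ Finset.Ioc m (m + A.sup id) := fun i hi =>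
    Finset.mem_Ioc.2 ⟨hA i hi, (Finset.le_sup (f := id) hi).trans (Nat.le_add_left _ _)⟩
  rw [← Q_appendOnes n k hle t hAL]
  exact isMaxApery_Q hk (ht.admissible_appendOnes A _) (by rw [P_appendOnes hle t hAL, hP])

theorem isMaxApery_Q_add_pair (hk : 1 ≤ k) (ht : Admissible m t) {i j : ℕ} (hmi : m < i)
    (hij : i < j) (hP : P m t + 2 ^ i + 2 ^ j = s n k 0 + 1) :
    IsMaxApery (GThabit n k) (s n k 0) (Q n k m t + s n k i + s n k j) := by
  have hi : 1 ≤ 2 ^ i := Nat.one_le_two_pow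
  have hj : 1 ≤ 2 ^ j := Nat.one_le_two_pow
  rw [add_assoc, ← Finset.sum_pair hij.ne]
  refine isMaxApery_Q_add_sum hk ht (by simp [hmi, hmi.trans hij]) ?_
  rw [Finset.sum_pair hij.ne]
  omega

theorem isMaxApery_pair (hk : 1 ≤ k) {i j : ℕ} (hi : 0 < i) (hij : i < j)
    (h : 2 ^ i + 2 ^ j = s n k 0 + 1) :
    IsMaxApery (GThabit n k) (s n k 0) (s n k i + s n k j) := by
  have := isMaxApery_Q_add_pair hk (t := 0) (by simp [Admissible]) hi hij (by simpa [P] using h)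
  simpa [Q] using this

theorem s_zero_zero (k : ℕ) : s 0 k 0 = 2 := by
  have := s_zero_add_two_pow 0 k
  rw [zero_add] at this
  omega

theorem isMaxApery_of_n_eq_zero (hk : 1 ≤ k) :
    IsMaxApery (GThabit 0 k) (s 0 k 0) (s 0 k 1) := by
  have := isMaxApery_Q_add_sum (n := 0) (m := 0) (t := 0) (A := {1}) hk (by simp [Admissible])
    (by simp) (by simp [P, s_zero_zero])
  simpa [Q] using this

theorem isMaxApery_of_k_eq_one (hn : n ≠ 0) :
    IsMaxApery (GThabit n 1) (s n 1 0) (s n 1 n + s n 1 (n + 1)) := by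
  refine isMaxApery_pair le_rfl (by omega) (by omega) ?_
  have := s_zero_add_two_pow n 1
  omega

theorem isMaxApery_of_k_lt_n (hk : 1 ≤ k) (hkn : k < n) (ht : Admissible (n - 2) t)
    (hP : P (n - 2) t = 2 ^ (n - 1) - 2 ^ k + 2) :
    IsMaxApery (GThabit n k) (s n k 0) (Q n k (n - 2) t + s n k (n - 1) + s n k (n + k)) := by
  refine isMaxApery_Q_add_pair hk ht (by omega) (by omega) ?_
  have hs := s_zero_add_two_pow n k
  have hle : 2 ^ k ≤ 2 ^ (n - 1) := Nat.pow_le_pow_right two_pos (by omega)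
  have hn : 2 ^ n = 2 ^ (n - 1) * 2 := by rw [← pow_succ, Nat.sub_add_cancel (by omega)]
  omega

theorem isMaxApery_of_n_eq_k (hn : 1 ≤ n) :
    IsMaxApery (GThabit n n) (s n n 0) (s n n 1 + s n n (2 * n)) := by
  refine isMaxApery_pair hn one_pos (by omega) ?_
  have := s_zero_add_two_pow n n
  rw [← two_mul] at this
  omega

theorem isMaxApery_of_n_lt_k (hnk : n < k) (ht : Admissible (k - 1) t)
    (hP : P (k - 1) t = 2 ^ n + n) :
    IsMaxApery (GThabit n k) (s n k 0)
      (Q n k (k - 1) t + ∑ i ∈ Finset.Icc k (n + k - 1), s n k i) := by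
  refine isMaxApery_Q_add_sum (by omega) ht (fun i hi => ?_) ?_
  · have := (Finset.mem_Icc.1 hi).1
    omega
  · have hsum := sum_Ico_two_pow_sub_one k n
    have hmin : ¬IsMin (n + k) := by
      rw [isMin_iff_eq_bot, Nat.bot_eq_zero]
      omega
    rw [← Finset.Icc_sub_one_right_eq_Ico_of_not_isMin hmin] at hsum
    have hs := s_zero_add_two_pow n k
    omega

theorem exists_admissible_P_eq_of_k_lt_n (hk : 2 ≤ k) (hkn : k < n) :
    ∃ t, Admissible (n - 2) t ∧ P (n - 2) t = 2 ^ (n - 1) - 2 ^ k + 2 := by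
  refine exists_admissible_P_eq _ ?_
  have hpow : 2 ^ 2 ≤ 2 ^ k := Nat.pow_le_pow_right two_pos hk
  have hle : 2 ^ k ≤ 2 ^ (n - 1) := Nat.pow_le_pow_right two_pos (by omega)
  rw [show n - 2 + 1 = n - 1 by omega]
  omega

theorem exists_admissible_P_eq_of_n_lt_k (hn : n ≠ 0) (hk : k ≠ 2) (hnk : n < k) :
    ∃ t, Admissible (k - 1) t ∧ P (k - 1) t = 2 ^ n + n := by
  refine exists_admissible_P_eq _ ?_
  obtain ⟨i, rfl⟩ : ∃ i, k = i + 3 := ⟨k - 3, by omega⟩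
  have hle : 2 ^ n ≤ 2 ^ (i + 2) := Nat.pow_le_pow_right two_pos (by omega)
  have hi := Nat.lt_two_pow_self (n := i)
  simp only [Nat.reduceSubDiff, pow_succ] at hle ⊢
  omega

theorem isMaxApery_one_two : IsMaxApery (GThabit 1 2) (s 1 2 0) 74 :=
  isMaxApery_Q one_le_two (admissible_single_two 2 2) (by decide)

end GThabit

end GenThabit

open GenThabit in
theorem mainTheorem3 (n k : ℕ) (hk : 1 ≤ k) :
    (n = 0 →
      IsGreatest (Ap (GThabit n k) (s n k 0)) (s n k 1) ∧
      FrobeniusNumber (s n k 1 - 2) (GThabit n k : Set ℕ)) ∧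
    (n ≠ 0 → k = 1 →
      IsGreatest (Ap (GThabit n k) (s n k 0)) (s n k n + s n k (n + 1)) ∧
      FrobeniusNumber (s n k n + s n k (n + 1) - s n k 0) (GThabit n k : Set ℕ)) ∧
    (2 ≤ k → k < n →
      (∃ t : ℕ → ℕ, Admissible (n - 2) t ∧ P (n - 2) t = 2 ^ (n - 1) - 2 ^ k + 2) ∧
      ∀ t : ℕ → ℕ, Admissible (n - 2) t → P (n - 2) t = 2 ^ (n - 1) - 2 ^ k + 2 →
        IsGreatest (Ap (GThabit n k) (s n k 0))
          (Q n k (n - 2) t + s n k (n - 1) + s n k (n + k)) ∧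
        FrobeniusNumber
          (Q n k (n - 2) t + s n k (n - 1) + s n k (n + k) - s n k 0) (GThabit n k : Set ℕ)) ∧
    (n = k →
      IsGreatest (Ap (GThabit n k) (s n k 0)) (s n k 1 + s n k (2 * n)) ∧
      FrobeniusNumber (s n k 1 + s n k (2 * n) - s n k 0) (GThabit n k : Set ℕ)) ∧
    (n ≠ 0 → k ≠ 2 → n < k →
      (∃ t : ℕ → ℕ, Admissible (k - 1) t ∧ P (k - 1) t = 2 ^ n + n) ∧
      ∀ t : ℕ → ℕ, Admissible (k - 1) t → P (k - 1) t = 2 ^ n + n →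
        IsGreatest (Ap (GThabit n k) (s n k 0))
          (Q n k (k - 1) t + ∑ i ∈ Finset.Icc k (n + k - 1), s n k i) ∧
        FrobeniusNumber
          (Q n k (k - 1) t + (∑ i ∈ Finset.Icc k (n + k - 1), s n k i) - s n k 0)
          (GThabit n k : Set ℕ)) ∧
    (n = 1 → k = 2 →
      IsGreatest (Ap (GThabit n k) (s n k 0)) 74 ∧
      FrobeniusNumber 67 (GThabit n k : Set ℕ)) := by
  refine ⟨?_, ?_, fun hk2 hkn => ⟨exists_admissible_P_eq_of_k_lt_n hk2 hkn, fun t => ?_⟩, ?_,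
    fun hn hk2 hnk => ⟨exists_admissible_P_eq_of_n_lt_k hn hk2 hnk, fun t => ?_⟩, ?_⟩
  · rintro rfl
    exact ⟨(isMaxApery_of_n_eq_zero hk).1, s_zero_zero k ▸ (isMaxApery_of_n_eq_zero hk).2⟩
  · rintro hn rfl
    exact isMaxApery_of_k_eq_one hn
  · exact isMaxApery_of_k_lt_n hk hkn
  · rintro rfl
    exact isMaxApery_of_n_eq_k hk
  · exact isMaxApery_of_n_lt_k hnk
  · rintro rfl rfl
    exact isMaxApery_one_two
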